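/- Let $N\ge 2$, let $A\in\mathbb{R}^{N\times N}$ be symmetric positive definite with eigenvalues $0<\lambda_1<\dots<\lambda_N$ and associated eigenvectors $v_1,\dots,v_N$, and let $b\in\mathbb{R}^N$. Let $\{x_n\}_{n\ge 0}$ be generated by the minimal gradient (MG) method for $Ax=b$, that is, \[ g_n=Ax_n-b,\qquad \alpha_n^{\mathrm{MG}}=\frac{g_n^\intercal A g_n}{g_n^\intercal A^2 g_n},\qquad x_{n+1}=x_n-\alpha_n^{\mathrm{MG}}g_n , \] and write $g_0=\sum_{i=1}^N\zeta_{i,0}v_i$. Assume that the starting point $x_0$ is such that $\zeta_{1,0}\neq 0$ and $\zeta_{N,0}\neq 0$. For $n\ge 1$ put \[ \alpha_n^{\mathrm{A2}}=\left(\frac{1}{\alpha_{n-1}^{\mathrm{MG}}}+\frac{1}{\alpha_n^{\mathrm{MG}}}\right)^{-1}, \] \[ \alpha_n^{\mathrm{Y2}}=2\left(\sqrt{\left(\frac{1}{\alpha_{n-1}^{\mathrm{MG}}}-\frac{1}{\alpha_n^{\mathrm{MG}}}\right)^2+\frac{4g_n^\intercal Ag_n}{\left(\alpha_{n-1}^{\mathrm{MG}}\right)^2g_{n-1}^\intercal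 Ag_{n-1}}}+\frac{1}{\alpha_{n-1}^{\mathrm{MG}}}+\frac{1}{\alpha_n^{\mathrm{MG}}}\right)^{-1}. \] Then \[ \lim_{n\to\infty}\alpha_n^{\mathrm{A2}}=\frac{1}{\lambda_1+\lambda_N},\qquad \lim_{n\to\infty}\alpha_n^{\mathrm{Y2}}=\frac{1}{\lambda_N}, \] and \[ \lim_{n\to\infty}\left(\frac{1}{\alpha_{n-1}^{\mathrm{MG}}\alpha_n^{\mathrm{MG}}}-\frac{g_n^\intercal Ag_n}{\left(\alpha_{n-1}^{\mathrm{MG}}\right)^2g_{n-1}^\intercal Ag_{n-1}}\right)=\lambda_1\lambda_N . \] -/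

import Mathlib

open Matrix Filter Topology

noncomputable section

/-- The gradient `A x - b` of the quadratic function `x ↦ (1/2) xᵀ A x - bᵀ x`. -/
def grad {N : ℕ} (A : Matrix (Fin N) (Fin N) ℝ) (b x : Fin N → ℝ) : Fin N → ℝ :=
  A *ᵥ x - b

/-- The minimal gradient (MG) steplength `gᵀ A g / gᵀ A² g`. -/
def alphaMG {N : ℕ} (A : Matrix (Fin N) (Fin N) ℝ) (g : Fin N → ℝ) : ℝ :=
  (g ⬝ᵥ A *ᵥ g) / (g ⬝ᵥ (A ^ 2) *ᵥ g)

/-- `x 0, x 1, x 2, …` is generated by the MG method for `A x = b`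
(with the arbitrary starting point `x 0`). -/
def IsMGSequence {N : ℕ} (A : Matrix (Fin N) (Fin N) ℝ) (b : Fin N → ℝ)
    (x : ℕ → Fin N → ℝ) : Prop :=
  ∀ n, x (n + 1) = x n - alphaMG A (grad A b (x n)) • grad A b (x n)

/-- The steplength A2, from the previous gradient `g'` and the current gradient `g`. -/
def alphaA2 {N : ℕ} (A : Matrix (Fin N) (Fin N) ℝ) (g' g : Fin N → ℝ) : ℝ :=
  (1 / alphaMG A g' + 1 / alphaMG A g)⁻¹

/-- The steplength Y2, from the previous gradient `g'` and the current gradient `g`. -/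
def alphaY2 {N : ℕ} (A : Matrix (Fin N) (Fin N) ℝ) (g' g : Fin N → ℝ) : ℝ :=
  2 * (Real.sqrt ((1 / alphaMG A g' - 1 / alphaMG A g) ^ 2
      + 4 * (g ⬝ᵥ A *ᵥ g) / (alphaMG A g' ^ 2 * (g' ⬝ᵥ A *ᵥ g')))
    + 1 / alphaMG A g' + 1 / alphaMG A g)⁻¹

end

/-! Give each eigenvalue its normalized share of gᵀAg. An MG step multiplies the i-th coefficient of
g by 1 - αλ_i, and 1/α is the mean m of the spectrum under these weights. So a step multiplies each
weight by (λ_i - m)² and renormalizes, and both ratios in the statement are functions of the means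
and variances s.

Let Q(t) = (t - m)(t - m') - s, with m' the next mean. Then s' s = s² + E[Q²] (`wvar_wstep`), so the
variance increases to a positive limit and E[Q²] → 0. Since s stays away from 0, Q must be small at
two eigenvalues (`exists_pair_near_wquad`), so its coefficients approach a finite set. Two steps
change the weights by o(1), so these coefficients settle at one point (`exists_tendsto_of_finite`).
The limiting roots are extremal: otherwise the weight of some extremal eigenvalue would be
eventually nondecreasing along every second step and yet tend to 0 (`tendsto_wquad_coeff`). The
three limits are functions of the coefficients of Q. -/

/-- The mean of `l` under the weights `p`. -/
def wmean {ι : Type*} [Fintype ι] (l p : ι → ℝ) : ℝ := ∑ i, p i * l i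

/-- The variance of `l` under the weights `p`. -/
def wvar {ι : Type*} [Fintype ι] (l p : ι → ℝ) : ℝ := ∑ i, p i * (l i - wmean l p) ^ 2

/-- The transformation of spectral weights induced by one gradient step. -/
noncomputable def wstep {ι : Type*} [Fintype ι] (l p : ι → ℝ) : ι → ℝ :=
  fun i => p i * (l i - wmean l p) ^ 2 / wvar l p

/-- The product of the first two residual factors, centred at its mean. -/
noncomputable def wquad {ι : Type*} [Fintype ι] (l p : ι → ℝ) (t : ℝ) : ℝ :=
  (t - wmean l p) * (t - wmean l (wstep l p)) - wvar l p

/-! ### One step on probability weights. -/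

section Weights

variable {ι : Type*} [Fintype ι] {l p : ι → ℝ}

lemma sum_wstep (hs : wvar l p ≠ 0) : ∑ i, wstep l p i = 1 := by
  simp only [wstep, ← Finset.sum_div]
  exact div_self hs

lemma wvar_nonneg (hp : ∀ i, 0 ≤ p i) : 0 ≤ wvar l p :=
  Finset.sum_nonneg fun i _ => mul_nonneg (hp i) (sq_nonneg _)

lemma wstep_nonneg (hp : ∀ i, 0 ≤ p i) (i : ι) : 0 ≤ wstep l p i :=
  div_nonneg (mul_nonneg (hp i) (sq_nonneg _)) (wvar_nonneg hp)

lemma le_one_of_sum_eq_one (hp : ∀ i, 0 ≤ p i) (h1 : ∑ i, p i = 1) (i : ι) : p i ≤ 1 :=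
  h1 ▸ Finset.single_le_sum (fun j _ => hp j) (Finset.mem_univ i)

lemma sum_mul_sub_wmean (h1 : ∑ i, p i = 1) : ∑ i, p i * (l i - wmean l p) = 0 := by
  simp only [mul_sub, Finset.sum_sub_distrib, ← Finset.sum_mul, h1, one_mul]
  exact sub_self _

lemma sum_mul_sq_sub (h1 : ∑ i, p i = 1) (c : ℝ) :
    ∑ i, p i * (l i - c) ^ 2 = wvar l p + (wmean l p - c) ^ 2 := by
  have h : ∀ i, p i * (l i - c) ^ 2 = p i * (l i - wmean l p) ^ 2
      + (2 * (wmean l p - c)) * (p i * (l i - wmean l p)) + p i * (wmean l p - c) ^ 2 :=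
    fun i => by ring
  simp only [h, Finset.sum_add_distrib, ← Finset.mul_sum, ← Finset.sum_mul, h1,
    sum_mul_sub_wmean h1]
  rw [← wvar]
  ring

lemma sum_mul_wquad (h1 : ∑ i, p i = 1) : ∑ i, p i * wquad l p (l i) = 0 := by
  have h : ∀ i, p i * wquad l p (l i) = p i * (l i - wmean l p) ^ 2
      + (wmean l p - wmean l (wstep l p)) * (p i * (l i - wmean l p)) - p i * wvar l p :=
    fun i => by unfold wquad; ring
  simp only [h, Finset.sum_add_distrib, Finset.sum_sub_distrib, ← Finset.mul_sum,
    ← Finset.sum_mul, h1, sum_mul_sub_wmean h1]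
  rw [← wvar]
  ring

/-- The left side is the p-mean of (Q + s)², where Q is `wquad` and s the variance; the cross term
vanishes because Q has mean zero. This makes the variance monotone along the flow and measures its
increase. -/
lemma wvar_wstep (h1 : ∑ i, p i = 1) (hs : wvar l p ≠ 0) :
    wvar l (wstep l p) * wvar l p = wvar l p ^ 2 + ∑ i, p i * wquad l p (l i) ^ 2 := by
  have h : ∀ i, wstep l p i * (l i - wmean l (wstep l p)) ^ 2 * wvar l p =
      p i * wquad l p (l i) ^ 2 + 2 * wvar l p * (p i * wquad l p (l i))
        + p i * wvar l p ^ 2 := fun i => by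
    have : wstep l p i * wvar l p = p i * (l i - wmean l p) ^ 2 := div_mul_cancel₀ _ hs
    rw [mul_right_comm, this]
    unfold wquad
    ring
  rw [wvar, Finset.sum_mul]
  simp only [h, Finset.sum_add_distrib, ← Finset.mul_sum, ← Finset.sum_mul, h1,
    sum_mul_wquad h1]
  ring

lemma wstep_wstep (hs : wvar l p ≠ 0) (i : ι) :
    wstep l (wstep l p) i =
      p i * (wquad l p (l i) + wvar l p) ^ 2 / (wvar l p * wvar l (wstep l p)) := by
  have : wquad l p (l i) + wvar l p = (l i - wmean l p) * (l i - wmean l (wstep l p)) := by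
    unfold wquad; ring
  rw [this, wstep, wstep]
  field_simp

lemma wmean_mem_Icc (hp : ∀ i, 0 ≤ p i) (h1 : ∑ i, p i = 1) {a b : ι} (ha : ∀ i, l a ≤ l i)
    (hb : ∀ i, l i ≤ l b) : wmean l p ∈ Set.Icc (l a) (l b) := by
  constructor
  · calc l a = ∑ i, p i * l a := by rw [← Finset.sum_mul, h1, one_mul]
      _ ≤ _ := Finset.sum_le_sum fun i _ => mul_le_mul_of_nonneg_left (ha i) (hp i)
  · calc wmean l p ≤ ∑ i, p i * l b :=
          Finset.sum_le_sum fun i _ => mul_le_mul_of_nonneg_left (hb i) (hp i)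
      _ = l b := by rw [← Finset.sum_mul, h1, one_mul]

lemma wmean_mem_Ioo (hp : ∀ i, 0 ≤ p i) (h1 : ∑ i, p i = 1) {a b : ι} (ha : ∀ i, l a ≤ l i)
    (hb : ∀ i, l i ≤ l b) (hab : l a < l b) (hpa : 0 < p a) (hpb : 0 < p b) :
    wmean l p ∈ Set.Ioo (l a) (l b) := by
  constructor
  · calc l a = ∑ i, p i * l a := by rw [← Finset.sum_mul, h1, one_mul]
      _ < _ := Finset.sum_lt_sum (fun i _ => mul_le_mul_of_nonneg_left (ha i) (hp i))
        ⟨b, Finset.mem_univ b, mul_lt_mul_of_pos_left hab hpb⟩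
  · calc wmean l p < ∑ i, p i * l b :=
          Finset.sum_lt_sum (fun i _ => mul_le_mul_of_nonneg_left (hb i) (hp i))
            ⟨a, Finset.mem_univ a, mul_lt_mul_of_pos_left hab hpa⟩
      _ = l b := by rw [← Finset.sum_mul, h1, one_mul]

lemma wvar_le (hp : ∀ i, 0 ≤ p i) (h1 : ∑ i, p i = 1) {a b : ι} (ha : ∀ i, l a ≤ l i)
    (hb : ∀ i, l i ≤ l b) : wvar l p ≤ (l b - l a) ^ 2 := by
  obtain ⟨h2, h3⟩ := wmean_mem_Icc hp h1 ha hb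
  calc wvar l p ≤ ∑ i, p i * (l b - l a) ^ 2 :=
        Finset.sum_le_sum fun i _ => mul_le_mul_of_nonneg_left
          (sq_le_sq.2 <| by
            rw [abs_of_nonneg (a := l b - l a) (by linarith), abs_le]
            constructor <;> linarith [ha i, hb i]) (hp i)
    _ = _ := by rw [← Finset.sum_mul, h1, one_mul]

/-- If the variance is bounded below, two of the weights are, so the coefficients of `wquad`
are close to those of a monic quadratic with two distinct roots among the values of `l`. -/
lemma exists_pair_near_wquad (hp : ∀ i, 0 ≤ p i) (h1 : ∑ i, p i = 1) {a b : ι} (ha : ∀ i, l a ≤ l i) (hb : ∀ i, l i ≤ l b) {w : ℝ}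
    (hw : 0 < w) (hwp : w ≤ wvar l p) :
    ∃ i j, i ≠ j ∧
      wquad l p (l i) ^ 2 ≤ Fintype.card ι * ∑ k, p k * wquad l p (l k) ^ 2 ∧
      wquad l p (l j) ^ 2 ≤
        Fintype.card ι * (l b - l a) ^ 2 / w * ∑ k, p k * wquad l p (l k) ^ 2 := by
  have hne : Nonempty ι := ⟨a⟩
  have hN : (0 : ℝ) < Fintype.card ι := by exact_mod_cast Fintype.card_pos
  set V := ∑ k, p k * wquad l p (l k) ^ 2 with hV
  have hle : ∀ k, p k * wquad l p (l k) ^ 2 ≤ V := fun k =>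
    Finset.single_le_sum (f := fun k => p k * wquad l p (l k) ^ 2)
      (fun j _ => mul_nonneg (hp j) (sq_nonneg _)) (Finset.mem_univ k)
  -- Pigeonhole twice: some weight is at least the average, and the second moment about `l i` is at
  -- least the variance, so some term of it is at least w / card. That term is nonzero, hence j ≠ i.
  obtain ⟨i, -, hi⟩ := Finset.exists_le_of_sum_le (s := Finset.univ)
    (f := fun _ : ι => (1 : ℝ) / Fintype.card ι) (g := p) Finset.univ_nonempty
    (by rw [h1]; simp)
  obtain ⟨j, -, hj⟩ := Finset.exists_le_of_sum_le (s := Finset.univ)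
    (f := fun _ : ι => w / Fintype.card ι) (g := fun j => p j * (l j - l i) ^ 2)
    Finset.univ_nonempty (by
      rw [sum_mul_sq_sub h1, Finset.sum_const, Finset.card_univ, nsmul_eq_mul,
        mul_div_cancel₀ _ hN.ne']
      nlinarith [sq_nonneg (wmean l p - l i)])
  have hwN : 0 < w / Fintype.card ι := div_pos hw hN
  refine ⟨i, j, ?_, ?_, ?_⟩
  · rintro rfl
    simp only [sub_self] at hj
    nlinarith
  · rw [div_le_iff₀ hN] at hi
    nlinarith [hle i, sq_nonneg (wquad l p (l i))]
  · have hL : (l j - l i) ^ 2 ≤ (l b - l a) ^ 2 := sq_le_sq' (by linarith [ha i, ha j, hb i, hb j])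
      (by linarith [ha i, ha j, hb i, hb j])
    have hj' : w ≤ p j * (l b - l a) ^ 2 * Fintype.card ι := by
      rw [div_le_iff₀ hN] at hj
      exact hj.trans (mul_le_mul_of_nonneg_right (mul_le_mul_of_nonneg_left hL (hp j)) hN.le)
    rw [div_mul_eq_mul_div, le_div_iff₀ hw]
    calc wquad l p (l j) ^ 2 * w
        ≤ wquad l p (l j) ^ 2 * (p j * (l b - l a) ^ 2 * Fintype.card ι) :=
          mul_le_mul_of_nonneg_left hj' (sq_nonneg _)
      _ = Fintype.card ι * (l b - l a) ^ 2 * (p j * wquad l p (l j) ^ 2) := by ring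
      _ ≤ _ := mul_le_mul_of_nonneg_left (hle j) (by positivity)

end Weights

/-! ### Convergence near a finite set. -/

/-- A sequence with vanishing increments that approaches a finite set converges to one of its
points. -/
lemma exists_tendsto_of_finite {X : Type*} [MetricSpace X] {F : Set X} (hF : F.Finite)
    {u : ℕ → X} (hu : Tendsto (fun n => dist (u n) (u (n + 1))) atTop (𝓝 0))
    (h : ∀ ε > 0, ∀ᶠ n in atTop, ∃ s ∈ F, dist (u n) s < ε) :
    ∃ s ∈ F, Tendsto u atTop (𝓝 s) := by
  obtain ⟨D, hD, hsep⟩ : ∃ D > 0, ∀ s ∈ F, ∀ t ∈ F, dist s t < D → s = t := by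
    have h0 : ∀ᶠ D in 𝓝[>] (0 : ℝ), ∀ s ∈ F, ∀ t ∈ F, dist s t < D → s = t := by
      rw [eventually_all_finite hF]
      intro s _
      rw [eventually_all_finite hF]
      intro t _
      by_cases hst : s = t
      · exact Eventually.of_forall fun _ _ => hst
      · filter_upwards [Ioo_mem_nhdsGT (dist_pos.2 hst)] with D hD hlt
        exact absurd hlt (not_lt.2 hD.2.le)
    obtain ⟨D, hD, hpos⟩ := (h0.and self_mem_nhdsWithin).exists
    exact ⟨D, hpos, hD⟩
  -- One increment and two approximation errors, each below D / 3, sum to less than the separation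
  -- D, so the nearby point of F cannot change.
  have hD3 : 0 < D / 3 := by positivity
  obtain ⟨n₀, hn₀⟩ := eventually_atTop.1
    ((h _ hD3).and (hu.eventually (gt_mem_nhds hD3)))
  obtain ⟨s, hs, hs0⟩ := (hn₀ n₀ le_rfl).1
  have hall : ∀ n ≥ n₀, dist (u n) s < D / 3 := by
    intro n hn
    induction n, hn using Nat.le_induction with
    | base => exact hs0
    | succ n hn ih =>
      obtain ⟨t, ht, htn⟩ := (hn₀ (n + 1) (by omega)).1
      have : dist s t < D := by
        linarith [dist_triangle4 s (u n) (u (n + 1)) t, dist_comm s (u n), (hn₀ n hn).2]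
      rwa [hsep s hs t ht this]
  refine ⟨s, hs, Metric.tendsto_nhds.2 fun ε hε => ?_⟩
  filter_upwards [h (min ε (D / 3)) (lt_min hε hD3), eventually_ge_atTop n₀] with n hn hge
  obtain ⟨t, ht, htn⟩ := hn
  have : dist s t < D := by
    linarith [dist_triangle s (u n) t, dist_comm s (u n), hall n hge, htn.trans_le (min_le_right _ _)]
  rw [hsep s hs t ht this]
  exact htn.trans_le (min_le_left _ _)

/-! ### Asymptotics of the iterated weights. -/

section Flow

variable {ι : Type*} [Fintype ι] {l : ι → ℝ} {p : ℕ → ι → ℝ}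

/-- Along the flow, the weights form a probability vector charging both extremal points. -/
lemma flow_invariant (hstep : ∀ n, p (n + 1) = wstep l (p n)) (hp : ∀ i, 0 ≤ p 0 i)
    (h1 : ∑ i, p 0 i = 1) {a b : ι} (ha : ∀ i, l a ≤ l i) (hb : ∀ i, l i ≤ l b)
    (hab : l a < l b) (hpa : 0 < p 0 a) (hpb : 0 < p 0 b) (n : ℕ) :
    (∀ i, 0 ≤ p n i) ∧ ∑ i, p n i = 1 ∧ 0 < p n a ∧ 0 < p n b ∧ 0 < wvar l (p n) := by
  have key : ∀ q : ι → ℝ, (∀ i, 0 ≤ q i) → ∑ i, q i = 1 → 0 < q a → 0 < q b →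
      0 < q a * (l a - wmean l q) ^ 2 ∧ 0 < q b * (l b - wmean l q) ^ 2 ∧ 0 < wvar l q := by
    intro q hq h1 hqa hqb
    obtain ⟨h2, h3⟩ := wmean_mem_Ioo hq h1 ha hb hab hqa hqb
    have h4 : 0 < q a * (l a - wmean l q) ^ 2 := mul_pos hqa (sq_pos_of_neg (by linarith))
    refine ⟨h4, mul_pos hqb (pow_pos (by linarith) 2), h4.trans_le ?_⟩
    exact Finset.single_le_sum (f := fun i => q i * (l i - wmean l q) ^ 2)
      (fun j _ => mul_nonneg (hq j) (sq_nonneg _)) (Finset.mem_univ a)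
  induction n with
  | zero => exact ⟨hp, h1, hpa, hpb, (key _ hp h1 hpa hpb).2.2⟩
  | succ n ih =>
    obtain ⟨hp, h1, hpa, hpb, hs⟩ := ih
    obtain ⟨h4, h5, -⟩ := key _ hp h1 hpa hpb
    rw [hstep n]
    have g0 := wstep_nonneg (l := l) hp
    have g1 := sum_wstep hs.ne'
    have ga : 0 < wstep l (p n) a := div_pos h4 hs
    have gb : 0 < wstep l (p n) b := div_pos h5 hs
    exact ⟨g0, g1, ga, gb, (key _ g0 g1 ga gb).2.2⟩

/-- The Akaike-type theorem: the coefficients of `wquad` converge along the flow to those of the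
quadratic vanishing at the two extremal points. -/
theorem tendsto_wquad_coeff (hl : Function.Injective l)
    (hstep : ∀ n, p (n + 1) = wstep l (p n)) (hp : ∀ i, 0 ≤ p 0 i)
    (h1 : ∑ i, p 0 i = 1) {a b : ι} (ha : ∀ i, l a ≤ l i) (hb : ∀ i, l i ≤ l b)
    (hab : l a < l b) (hpa : 0 < p 0 a) (hpb : 0 < p 0 b) :
    Tendsto (fun n => wmean l (p n) + wmean l (p (n + 1))) atTop (𝓝 (l a + l b)) ∧
    Tendsto (fun n => wmean l (p n) * wmean l (p (n + 1)) - wvar l (p n)) atTop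
      (𝓝 (l a * l b)) := by
  have inv := flow_invariant hstep hp h1 ha hb hab hpa hpb
  set m : ℕ → ℝ := fun n => wmean l (p n) with hm
  set s : ℕ → ℝ := fun n => wvar l (p n) with hsdef
  set Q : ℕ → ℝ → ℝ := fun n => wquad l (p n) with hQ
  set V : ℕ → ℝ := fun n => ∑ k, p n k * Q n (l k) ^ 2 with hVdef
  have hspos : ∀ n, 0 < s n := fun n => (inv n).2.2.2.2
  have hle1 : ∀ n i, p n i ≤ 1 := fun n i => le_one_of_sum_eq_one (inv n).1 (inv n).2.1 i
  have hQeq : ∀ n t, Q n t = t ^ 2 - t * (m n + m (n + 1)) + (m n * m (n + 1) - s n) := by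
    intro n t
    simp only [hQ, hm, hsdef, wquad, hstep n]
    ring
  have hVeq : ∀ n, V n = s n * (s (n + 1) - s n) := by
    intro n
    have := wvar_wstep (inv n).2.1 (hspos n).ne'
    rw [← hstep n] at this
    simp only [hVdef, hsdef, hQ]
    linarith
  have hVle : ∀ n k, p n k * Q n (l k) ^ 2 ≤ V n := fun n k =>
    Finset.single_le_sum (f := fun k => p n k * Q n (l k) ^ 2)
      (fun j _ => mul_nonneg ((inv n).1 j) (sq_nonneg _)) (Finset.mem_univ k)
  have hV0 : ∀ n, 0 ≤ V n := fun n =>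
    Finset.sum_nonneg fun j _ => mul_nonneg ((inv n).1 j) (sq_nonneg _)
  have hmono : Monotone s := monotone_nat_of_le_succ fun n => by
    have h := hV0 n
    rw [hVeq] at h
    linarith [nonneg_of_mul_nonneg_right h (hspos n)]
  obtain ⟨σ, hσ⟩ : ∃ σ, Tendsto s atTop (𝓝 σ) :=
    ⟨_, tendsto_atTop_ciSup hmono ⟨(l b - l a) ^ 2, by
      rintro _ ⟨n, rfl⟩
      exact wvar_le (inv n).1 (inv n).2.1 ha hb⟩⟩
  have hσpos : 0 < σ := (hspos 0).trans_le (hmono.ge_of_tendsto hσ 0)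
  have hσ' : Tendsto (fun n => s (n + 1)) atTop (𝓝 σ) := (tendsto_add_atTop_iff_nat 1).2 hσ
  have hV : Tendsto V atTop (𝓝 0) := by
    have := hσ.mul (hσ'.sub hσ)
    rw [sub_self, mul_zero] at this
    exact this.congr fun n => (hVeq n).symm
  have hpQ2 : ∀ k, Tendsto (fun n => p n k * Q n (l k) ^ 2) atTop (𝓝 0) := fun k =>
    squeeze_zero (fun n => mul_nonneg ((inv n).1 k) (sq_nonneg _)) (fun n => hVle n k) hV
  have hpQ : ∀ k, Tendsto (fun n => p n k * Q n (l k)) atTop (𝓝 0) := fun k => by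
    have h2 : Tendsto (fun n => (p n k * Q n (l k)) ^ 2) atTop (𝓝 0) :=
      squeeze_zero (fun n => sq_nonneg _) (fun n => by
        have := mul_le_mul_of_nonneg_right (hle1 n k)
          (mul_nonneg ((inv n).1 k) (sq_nonneg (Q n (l k))))
        calc (p n k * Q n (l k)) ^ 2 = p n k * (p n k * Q n (l k) ^ 2) := by ring
          _ ≤ p n k * Q n (l k) ^ 2 := by linarith) (hpQ2 k)
    have h3 := h2.sqrt
    simp only [Real.sqrt_sq_eq_abs, Real.sqrt_zero] at h3
    exact (tendsto_zero_iff_abs_tendsto_zero _).2 h3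
  have htwo : ∀ n k, p (n + 2) k = p n k * (Q n (l k) + s n) ^ 2 / (s n * s (n + 1)) := by
    intro n k
    have := wstep_wstep (l := l) (p := p n) (hspos n).ne' k
    rwa [← hstep n, ← hstep (n + 1)] at this
  -- Expand (Q + s)² in `htwo`: the terms with Q vanish in the limit, and the rest is p times a
  -- ratio tending to 1. Only two-step differences are small; on two points a single step swaps the
  -- weights.
  have hpdiff : ∀ k, Tendsto (fun n => p (n + 2) k - p n k) atTop (𝓝 0) := fun k => by
    have hA : Tendsto (fun n => (p n k * Q n (l k) ^ 2 + 2 * s n * (p n k * Q n (l k)))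
        / (s n * s (n + 1))) atTop (𝓝 0) := by
      have := ((hpQ2 k).add ((hσ.const_mul 2).mul (hpQ k))).div (hσ.mul hσ')
        (mul_pos hσpos hσpos).ne'
      simp only [mul_zero, add_zero, zero_div] at this
      exact this
    have hB : Tendsto (fun n => p n k * (s n / s (n + 1) - 1)) atTop (𝓝 0) := by
      have h0 : Tendsto (fun n => s n / s (n + 1) - 1) atTop (𝓝 0) := by
        have := (hσ.div hσ' hσpos.ne').sub_const 1
        rwa [div_self hσpos.ne', sub_self] at this
      refine squeeze_zero_norm (fun n => ?_) (tendsto_zero_iff_norm_tendsto_zero.1 h0)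
      rw [norm_mul, Real.norm_of_nonneg ((inv n).1 k)]
      exact mul_le_of_le_one_left (norm_nonneg _) (hle1 n k)
    have hAB := hA.add hB
    rw [add_zero] at hAB
    refine hAB.congr fun n => ?_
    have e1 := (hspos n).ne'
    have e2 := (hspos (n + 1)).ne'
    rw [htwo]
    field_simp
    ring
  have hmdiff : Tendsto (fun n => m (n + 2) - m n) atTop (𝓝 0) := by
    have : Tendsto (fun n => ∑ k, (p (n + 2) k - p n k) * l k) atTop (𝓝 (∑ k : ι, 0 * l k)) :=
      tendsto_finsetSum _ fun k _ => (hpdiff k).mul_const (l k)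
    simp only [zero_mul, Finset.sum_const_zero] at this
    refine this.congr fun n => ?_
    simp only [hm, wmean, sub_mul, Finset.sum_sub_distrib]
  -- These are the coefficients of Q up to sign. Consecutive values share m (n + 1), so their
  -- difference involves only m n - m (n + 2) and s (n + 1) - s n.
  set u : ℕ → ℝ × ℝ := fun n => (m n + m (n + 1), m n * m (n + 1) - s n) with hu
  have hudiff : Tendsto (fun n => dist (u n) (u (n + 1))) atTop (𝓝 0) := by
    have hmb : ∀ n, ‖m n‖ ≤ max |l a| |l b| := fun n => by
      obtain ⟨h2, h3⟩ := wmean_mem_Icc (inv n).1 (inv n).2.1 ha hb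
      exact abs_le_max_abs_abs h2 h3
    have hfst : Tendsto (fun n => ‖m n - m (n + 2)‖) atTop (𝓝 0) := by
      simpa [norm_sub_rev] using hmdiff.norm
    have hsnd : Tendsto (fun n => max |l a| |l b| * ‖m n - m (n + 2)‖ + ‖s (n + 1) - s n‖)
        atTop (𝓝 0) := by
      simpa using (hfst.const_mul (max |l a| |l b|)).add (hσ'.sub hσ).norm
    have hmax := hfst.max hsnd
    rw [max_self] at hmax
    refine squeeze_zero (fun _ => dist_nonneg) (fun n => ?_) hmax
    rw [Prod.dist_eq, dist_eq_norm, dist_eq_norm]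
    refine max_le_max (le_of_eq (congrArg _ ?_)) ?_
    · simp only [hu]; ring
    · calc ‖(u n).2 - (u (n + 1)).2‖ = ‖m (n + 1) * (m n - m (n + 2)) + (s (n + 1) - s n)‖ := by
            congr 1; simp only [hu]; ring
        _ ≤ ‖m (n + 1) * (m n - m (n + 2))‖ + ‖s (n + 1) - s n‖ := norm_add_le _ _
        _ ≤ _ := by
          rw [norm_mul]
          exact add_le_add_left (mul_le_mul_of_nonneg_right (hmb _) (norm_nonneg _)) _
  set F : Set (ℝ × ℝ) :=
    (fun ij : ι × ι => (l ij.1 + l ij.2, l ij.1 * l ij.2)) '' {ij | ij.1 ≠ ij.2} with hFdef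
  have hF : F.Finite := (Set.toFinite _).image _
  have hnear : ∀ ε > 0, ∀ᶠ n in atTop, ∃ t ∈ F, dist (u n) t < ε := by
    intro ε hε
    -- If |Q| < δ at two distinct nodes, interpolation bounds the errors in the sum and product of
    -- the roots by these two expressions.
    have hev : ∀ i j : ι, i ≠ j → ∀ᶠ δ in 𝓝[>] (0 : ℝ),
        2 * δ / |l j - l i| < ε ∧ δ + |l i| * (2 * δ / |l j - l i|) < ε := by
      intro i j hij
      have c1 : Continuous fun δ : ℝ => 2 * δ / |l j - l i| := by fun_prop
      have c2 : Continuous fun δ : ℝ => δ + |l i| * (2 * δ / |l j - l i|) := by fun_prop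
      refine nhdsWithin_le_nhds (Filter.Eventually.and ?_ ?_)
      · exact c1.continuousAt.eventually (gt_mem_nhds (by simpa using hε))
      · exact c2.continuousAt.eventually (gt_mem_nhds (by simpa using hε))
    obtain ⟨δ, hδ, hδ0⟩ : ∃ δ : ℝ, (∀ i j : ι, i ≠ j → 2 * δ / |l j - l i| < ε ∧
        δ + |l i| * (2 * δ / |l j - l i|) < ε) ∧ 0 < δ := by
      refine ((eventually_all.2 fun i => eventually_all.2 fun j => ?_).and
        self_mem_nhdsWithin : ∀ᶠ δ in 𝓝[>] (0 : ℝ), _).exists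
      by_cases hij : i = j
      · exact Eventually.of_forall fun _ h => absurd hij h
      · filter_upwards [hev i j hij] with δ h _ using h
    have hδ2 : 0 < δ ^ 2 := by positivity
    have b1 := (hV.const_mul (Fintype.card ι : ℝ)).eventually_lt_const
      (u := δ ^ 2) (by simpa using hδ2)
    -- By monotonicity `s 0` is a uniform lower bound for the variance.
    have b2 := (hV.const_mul (Fintype.card ι * (l b - l a) ^ 2 / s 0)).eventually_lt_const
      (u := δ ^ 2) (by simpa using hδ2)
    filter_upwards [b1, b2] with n hn1 hn2
    obtain ⟨i, j, hij, hi, hj⟩ := exists_pair_near_wquad (inv n).1 (inv n).2.1 ha hb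
      (hspos 0) (hmono (Nat.zero_le n))
    have hi' : |Q n (l i)| < δ := abs_lt_of_sq_lt_sq (hi.trans_lt hn1) hδ0.le
    have hj' : |Q n (l j)| < δ := abs_lt_of_sq_lt_sq (hj.trans_lt hn2) hδ0.le
    have hne : 0 < |l j - l i| := abs_pos.2 (sub_ne_zero.2 fun h => hij (hl h).symm)
    have hS : |(u n).1 - (l i + l j)| ≤ 2 * δ / |l j - l i| := by
      rw [le_div_iff₀ hne, ← abs_mul]
      have : ((u n).1 - (l i + l j)) * (l j - l i) = Q n (l i) - Q n (l j) := by
        rw [hQeq, hQeq]; simp only [hu]; ring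
      rw [this]
      linarith [abs_sub (Q n (l i)) (Q n (l j))]
    have hP : |(u n).2 - l i * l j| ≤ δ + |l i| * (2 * δ / |l j - l i|) := by
      have : (u n).2 - l i * l j = Q n (l i) + l i * ((u n).1 - (l i + l j)) := by
        rw [hQeq]; simp only [hu]; ring
      rw [this]
      refine (abs_add_le _ _).trans (add_le_add hi'.le ?_)
      rw [abs_mul]
      exact mul_le_mul_of_nonneg_left hS (abs_nonneg _)
    refine ⟨_, ⟨(i, j), hij, rfl⟩, ?_⟩
    rw [Prod.dist_eq]
    exact max_lt (hS.trans_lt (hδ i j hij).1) (hP.trans_lt (hδ i j hij).2)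
  obtain ⟨_, ⟨⟨i, j⟩, hij, rfl⟩, hlim⟩ := exists_tendsto_of_finite hF hudiff hnear
  have hlimS : Tendsto (fun n => m n + m (n + 1)) atTop (𝓝 (l i + l j)) :=
    (continuous_fst.tendsto _).comp hlim
  have hlimP : Tendsto (fun n => m n * m (n + 1) - s n) atTop (𝓝 (l i * l j)) :=
    (continuous_snd.tendsto _).comp hlim
  have hQlim : ∀ t, Tendsto (fun n => Q n t) atTop (𝓝 ((t - l i) * (t - l j))) := by
    intro t
    have := ((hlimS.const_mul t).const_sub (t ^ 2)).add hlimP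
    rw [show (t - l i) * (t - l j) = t ^ 2 - t * (l i + l j) + l i * l j by ring]
    exact this.congr fun n => (hQeq n t).symm
  -- If the limit c of Q at `l k` were positive, the two-step factor would tend to (c + σ)² / σ² >
  -- 1, keeping `p (n₀ + 2 * r) k` above `p n₀ k`; but p Q² → 0 with c ≠ 0 forces p → 0. The sign
  -- condition holds at both extremal points.
  have hroot : ∀ k, (∀ n, 0 < p n k) → 0 ≤ (l k - l i) * (l k - l j) →
      (l k - l i) * (l k - l j) = 0 := by
    intro k hk hnn
    by_contra hne
    set c := (l k - l i) * (l k - l j) with hc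
    have hcpos : 0 < c := lt_of_le_of_ne hnn (Ne.symm hne)
    have hratio : Tendsto (fun n => (Q n (l k) + s n) ^ 2 / (s n * s (n + 1))) atTop
        (𝓝 ((c + σ) ^ 2 / (σ * σ))) :=
      (((hQlim (l k)).add hσ).pow 2).div (hσ.mul hσ') (mul_pos hσpos hσpos).ne'
    have hgt : 1 < (c + σ) ^ 2 / (σ * σ) := by
      rw [one_lt_div (mul_pos hσpos hσpos)]
      nlinarith
    obtain ⟨n₀, hn₀⟩ := eventually_atTop.1 (hratio.eventually (lt_mem_nhds hgt))
    have hgrow : ∀ r, p n₀ k ≤ p (n₀ + 2 * r) k := by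
      intro r
      induction r with
      | zero => exact le_rfl
      | succ r ih =>
        have e : n₀ + 2 * (r + 1) = (n₀ + 2 * r) + 2 := by ring
        rw [e, htwo, mul_div_assoc]
        exact ih.trans (le_mul_of_one_le_right ((inv _).1 k) (hn₀ _ (by omega)).le)
    have hpk : Tendsto (fun n => p n k) atTop (𝓝 0) := by
      have := (hpQ2 k).div ((hQlim (l k)).pow 2) (pow_ne_zero 2 hcpos.ne')
      rw [zero_div] at this
      refine this.congr' ?_
      filter_upwards [(hQlim (l k)).eventually_ne hne] with n hn
      exact mul_div_cancel_right₀ _ (pow_ne_zero 2 hn)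
    have hsub : Tendsto (fun r : ℕ => n₀ + 2 * r) atTop atTop :=
      tendsto_atTop_mono (fun r => by simp only [id]; omega) tendsto_id
    exact absurd (ge_of_tendsto' (hpk.comp hsub) hgrow) (not_le.2 (hk n₀))
  have hra := hroot a (fun n => (inv n).2.2.1)
    (mul_nonneg_of_nonpos_of_nonpos (by linarith [ha i]) (by linarith [ha j]))
  have hrb := hroot b (fun n => (inv n).2.2.2.1)
    (mul_nonneg (by linarith [hb i]) (by linarith [hb j]))
  have hval : l i + l j = l a + l b ∧ l i * l j = l a * l b := by
    rcases mul_eq_zero.1 hra with h | h <;> rcases mul_eq_zero.1 hrb with h' | h'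
    · linarith
    · rw [sub_eq_zero.1 h, sub_eq_zero.1 h']; exact ⟨rfl, rfl⟩
    · rw [sub_eq_zero.1 h, sub_eq_zero.1 h']; exact ⟨add_comm _ _, mul_comm _ _⟩
    · linarith
  rw [← hval.1, ← hval.2]
  exact ⟨hlimS, hlimP⟩

end Flow

/-! ### Gradients in an eigenbasis. -/

section Spectral

variable {N : ℕ} {A : Matrix (Fin N) (Fin N) ℝ} {eig : Fin N → ℝ} {v : Fin N → Fin N → ℝ}

lemma eigenvectors_dotProduct_eq_zero (hA : A.PosDef) (hv : ∀ i, A *ᵥ v i = eig i • v i)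
    (heig : Function.Injective eig) {i j : Fin N} (hij : i ≠ j) : v i ⬝ᵥ v j = 0 := by
  have hT : Aᵀ = A := by
    rw [← Matrix.conjTranspose_eq_transpose_of_trivial]; exact hA.isHermitian.eq
  have h : v i ⬝ᵥ A *ᵥ v j = A *ᵥ v i ⬝ᵥ v j := by
    rw [Matrix.dotProduct_mulVec, ← Matrix.mulVec_transpose, hT]
  rw [hv, hv, dotProduct_smul, smul_dotProduct, smul_eq_mul, smul_eq_mul] at h
  by_contra h0
  exact hij (heig (mul_right_cancel₀ h0 h).symm)

lemma eigenvalue_pos (hA : A.PosDef) (hv : ∀ i, v i ≠ 0 ∧ A *ᵥ v i = eig i • v i) (i : Fin N) :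
    0 < eig i := by
  have h := hA.dotProduct_mulVec_pos (hv i).1
  rw [(hv i).2, dotProduct_smul, smul_eq_mul] at h
  have h' : 0 ≤ star (v i) ⬝ᵥ v i := dotProduct_star_self_nonneg (v i)
  exact pos_of_mul_pos_left h h'

lemma sum_smul_dotProduct_sum_smul (hv : ∀ i j, i ≠ j → v i ⬝ᵥ v j = 0) (c d : Fin N → ℝ) :
    (∑ i, c i • v i) ⬝ᵥ (∑ i, d i • v i) = ∑ i, c i * d i * (v i ⬝ᵥ v i) := by
  rw [sum_dotProduct]
  refine Finset.sum_congr rfl fun i _ => ?_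
  rw [dotProduct_sum, Finset.sum_eq_single i]
  · rw [smul_dotProduct, dotProduct_smul, smul_eq_mul, smul_eq_mul, mul_assoc]
  · intro j _ hj
    rw [smul_dotProduct, dotProduct_smul, hv i j hj.symm, smul_zero, smul_zero]
  · exact fun h => absurd (Finset.mem_univ i) h

lemma mulVec_sum_smul (hv : ∀ i, A *ᵥ v i = eig i • v i) (c : Fin N → ℝ) :
    A *ᵥ (∑ i, c i • v i) = ∑ i, (c i * eig i) • v i := by
  rw [Matrix.mulVec_sum]
  refine Finset.sum_congr rfl fun i _ => ?_
  rw [Matrix.mulVec_smul, hv, smul_smul]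

/-- The coordinates in an eigenbasis of the gradients of the MG method. -/
def mgCoeff (eig : Fin N → ℝ) (α : ℕ → ℝ) (ζ : Fin N → ℝ) : ℕ → Fin N → ℝ
  | 0 => ζ
  | n + 1 => fun i => mgCoeff eig α ζ n i * (1 - α n * eig i)

lemma grad_eq_sum_mgCoeff {b : Fin N → ℝ} {x : ℕ → Fin N → ℝ} (hx : IsMGSequence A b x)
    (hv : ∀ i, A *ᵥ v i = eig i • v i) {ζ : Fin N → ℝ} (hζ : grad A b (x 0) = ∑ i, ζ i • v i)
    (n : ℕ) : grad A b (x n) =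
      ∑ i, mgCoeff eig (fun n => alphaMG A (grad A b (x n))) ζ n i • v i := by
  induction n with
  | zero => exact hζ
  | succ n ih =>
    have h : grad A b (x (n + 1)) =
        grad A b (x n) - alphaMG A (grad A b (x n)) • A *ᵥ grad A b (x n) := by
      rw [hx n, grad, Matrix.mulVec_sub, Matrix.mulVec_smul]
      simp only [grad]
      abel
    rw [h]
    -- The steplengths contain the gradient, so they are made opaque before the gradient is
    -- rewritten.
    generalize hα : (fun n => alphaMG A (grad A b (x n))) = α at ih ⊢
    have hαn : alphaMG A (grad A b (x n)) = α n := by rw [← hα]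
    rw [hαn, ih, mulVec_sum_smul hv, Finset.smul_sum, ← Finset.sum_sub_distrib]
    refine Finset.sum_congr rfl fun i _ => ?_
    rw [smul_smul, ← sub_smul, mgCoeff]
    congr 1
    ring

lemma dotProduct_mulVec_eq_sum (horth : ∀ i j, i ≠ j → v i ⬝ᵥ v j = 0)
    (hv : ∀ i, A *ᵥ v i = eig i • v i) (c : Fin N → ℝ) :
    (∑ i, c i • v i) ⬝ᵥ A *ᵥ (∑ i, c i • v i) = ∑ i, eig i * c i ^ 2 * (v i ⬝ᵥ v i) := by
  rw [mulVec_sum_smul hv, sum_smul_dotProduct_sum_smul horth]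
  exact Finset.sum_congr rfl fun i _ => by ring

lemma dotProduct_sq_mulVec_eq_sum (horth : ∀ i j, i ≠ j → v i ⬝ᵥ v j = 0)
    (hv : ∀ i, A *ᵥ v i = eig i • v i) (c : Fin N → ℝ) :
    (∑ i, c i • v i) ⬝ᵥ (A ^ 2) *ᵥ (∑ i, c i • v i) =
      ∑ i, eig i * c i ^ 2 * (v i ⬝ᵥ v i) * eig i := by
  rw [sq, ← Matrix.mulVec_mulVec, mulVec_sum_smul hv, mulVec_sum_smul hv,
    sum_smul_dotProduct_sum_smul horth]
  exact Finset.sum_congr rfl fun i _ => by ring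

end Spectral

/-! ### From MG to the weights, and the limits. -/

/-- The MG method in spectral form: the normalized weights follow `wstep`, the inverse steplength
is their mean, and the decrease of `gᵀ A g` is governed by their variance. -/
lemma exists_spectral_weights {N : ℕ} {A : Matrix (Fin N) (Fin N) ℝ} (hA : A.PosDef)
    {b : Fin N → ℝ} {x : ℕ → Fin N → ℝ} (hx : IsMGSequence A b x) {eig : Fin N → ℝ}
    {v : Fin N → Fin N → ℝ} (hv : ∀ i, v i ≠ 0 ∧ A *ᵥ v i = eig i • v i)
    (heig : Function.Injective eig) {ζ : Fin N → ℝ} (hζ : grad A b (x 0) = ∑ i, ζ i • v i)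
    {a c : Fin N} (ha : ∀ i, eig a ≤ eig i) (hc : ∀ i, eig i ≤ eig c) (hac : eig a < eig c)
    (hζa : ζ a ≠ 0) (hζc : ζ c ≠ 0) :
    ∃ p : ℕ → Fin N → ℝ, (∀ n, p (n + 1) = wstep eig (p n)) ∧ (∀ i, 0 ≤ p 0 i) ∧
      ∑ i, p 0 i = 1 ∧ 0 < p 0 a ∧ 0 < p 0 c ∧
      (∀ n, 1 / alphaMG A (grad A b (x n)) = wmean eig (p n)) ∧
      ∀ n, (grad A b (x (n + 1)) ⬝ᵥ A *ᵥ grad A b (x (n + 1)))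
        / (alphaMG A (grad A b (x n)) ^ 2 * (grad A b (x n) ⬝ᵥ A *ᵥ grad A b (x n))) =
        wvar eig (p n) := by
  have hpos := eigenvalue_pos hA hv
  have hv' := fun i => (hv i).2
  have horth : ∀ i j, i ≠ j → v i ⬝ᵥ v j = 0 :=
    fun i j hij => eigenvectors_dotProduct_eq_zero hA hv' heig hij
  have hvv : ∀ i, 0 < v i ⬝ᵥ v i := fun i => by
    have := Matrix.dotProduct_star_self_pos_iff.2 (hv i).1
    simpa using this
  set α : ℕ → ℝ := fun n => alphaMG A (grad A b (x n)) with hα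
  set z := mgCoeff eig α ζ with hz
  have hg : ∀ n, grad A b (x n) = ∑ i, z n i • v i := grad_eq_sum_mgCoeff hx hv' hζ
  -- The factor `eig i` reflects the A-inner product in the MG steplength; `v i ⬝ᵥ v i` appears
  -- because the eigenvectors are not normalized.
  set w : ℕ → Fin N → ℝ := fun n i => eig i * z n i ^ 2 * (v i ⬝ᵥ v i) with hw
  set W : ℕ → ℝ := fun n => ∑ i, w n i with hW
  have hgAg : ∀ n, grad A b (x n) ⬝ᵥ A *ᵥ grad A b (x n) = W n := fun n => by
    rw [hg n, dotProduct_mulVec_eq_sum horth hv']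
  have hαeq : ∀ n, α n = W n / ∑ i, w n i * eig i := fun n => by
    rw [hα]
    simp only [alphaMG]
    rw [hgAg, hg n, dotProduct_sq_mulVec_eq_sum horth hv']
  have hw0 : ∀ n i, 0 ≤ w n i := fun n i =>
    mul_nonneg (mul_nonneg (hpos i).le (sq_nonneg _)) (hvv i).le
  set p : ℕ → Fin N → ℝ := fun n i => w n i / W n with hp
  have hmean : ∀ n, 1 / α n = wmean eig (p n) := fun n => by
    rw [hαeq, one_div_div, wmean, Finset.sum_div]
    exact Finset.sum_congr rfl fun i _ => by simp only [hp]; ring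
  have hws : ∀ n i, w (n + 1) i = w n i * (1 - α n * eig i) ^ 2 := fun n i => by
    simp only [hw, hz, mgCoeff]; ring
  have hwpos : ∀ n i, z n i ≠ 0 → 0 < w n i := fun n i hi =>
    mul_pos (mul_pos (hpos i) (by positivity)) (hvv i)
  have hzW : ∀ n i, 0 < w n i → 0 < W n := fun n i hi =>
    hi.trans_le (Finset.single_le_sum (fun j _ => hw0 n j) (Finset.mem_univ i))
  have hp0 : ∀ n i, 0 ≤ p n i := fun n i => div_nonneg (hw0 n i)
    (Finset.sum_nonneg fun j _ => hw0 n j)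
  have hp1 : ∀ n, 0 < W n → ∑ i, p n i = 1 := fun n hn => by
    simp only [hp, ← Finset.sum_div]
    exact div_self hn.ne'
  have hαpos : ∀ n, 0 < W n → 0 < α n := fun n hn => by
    have : 0 < wmean eig (p n) :=
      (hpos a).trans_le (wmean_mem_Icc (hp0 n) (hp1 n hn) ha hc).1
    rw [← hmean] at this
    exact one_div_pos.1 this
  -- Here 1 - αλ = -α(λ - 1/α), and 1/α is the mean.
  have hstepw : ∀ n, 0 < W n → ∀ i, w (n + 1) i =
      W n * α n ^ 2 * (p n i * (eig i - wmean eig (p n)) ^ 2) := fun n hn i => by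
    have := (hαpos n hn).ne'
    rw [hws, ← hmean]
    simp only [hp]
    field_simp
    ring
  have hWs : ∀ n, 0 < W n → W (n + 1) = W n * α n ^ 2 * wvar eig (p n) := fun n hn => by
    rw [hW]
    simp only [hstepw n hn, ← Finset.mul_sum]
    rfl
  have hinv : ∀ n, 0 < w n a ∧ 0 < w n c := by
    intro n
    induction n with
    | zero => exact ⟨hwpos 0 a hζa, hwpos 0 c hζc⟩
    | succ n ih =>
      have hn := hzW n a ih.1
      obtain ⟨h2, h3⟩ := wmean_mem_Ioo (hp0 n) (hp1 n hn) ha hc hac (div_pos ih.1 hn)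
        (div_pos ih.2 hn)
      have hα2 := pow_pos (hαpos n hn) 2
      rw [hstepw n hn, hstepw n hn]
      exact ⟨mul_pos (mul_pos hn hα2) (mul_pos (div_pos ih.1 hn)
          (sq_pos_of_neg (by linarith))),
        mul_pos (mul_pos hn hα2) (mul_pos (div_pos ih.2 hn) (pow_pos (by linarith) 2))⟩
  have hWpos : ∀ n, 0 < W n := fun n => hzW n a (hinv n).1
  refine ⟨p, fun n => ?_, hp0 0, hp1 0 (hWpos 0), div_pos (hinv 0).1 (hWpos 0),
    div_pos (hinv 0).2 (hWpos 0), hmean, fun n => ?_⟩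
  · ext i
    have := (hαpos n (hWpos n)).ne'
    have := (hWpos n).ne'
    change w (n + 1) i / W (n + 1) = _
    rw [hstepw n (hWpos n), hWs n (hWpos n), wstep, mul_div_mul_left]
    positivity
  · rw [hgAg, hgAg, hWs n (hWpos n)]
    have h2 := (hαpos n (hWpos n)).ne'
    have h3 := (hWpos n).ne'
    change W n * α n ^ 2 * wvar eig (p n) / (α n ^ 2 * W n) = _
    field_simp

theorem theorem4 {N : ℕ} (hN : 2 ≤ N) (A : Matrix (Fin N) (Fin N) ℝ) (hA : A.PosDef)
    (b : Fin N → ℝ) (x : ℕ → Fin N → ℝ) (hx : IsMGSequence A b x)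
    (eig : Fin N → ℝ) (v : Fin N → Fin N → ℝ)
    (hv : ∀ i, v i ≠ 0 ∧ A *ᵥ v i = eig i • v i) (heig : StrictMono eig)
    (ζ : Fin N → ℝ) (hζ : grad A b (x 0) = ∑ i, ζ i • v i)
    (hfirst : ζ ⟨0, by omega⟩ ≠ 0) (hlast : ζ ⟨N - 1, by omega⟩ ≠ 0) :
    Tendsto (fun n => alphaA2 A (grad A b (x n)) (grad A b (x (n + 1)))) atTop
      (𝓝 (1 / (eig ⟨0, by omega⟩ + eig ⟨N - 1, by omega⟩))) ∧
    Tendsto (fun n => alphaY2 A (grad A b (x n)) (grad A b (x (n + 1)))) atTop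
      (𝓝 (1 / eig ⟨N - 1, by omega⟩)) ∧
    Tendsto (fun n =>
        1 / (alphaMG A (grad A b (x n)) * alphaMG A (grad A b (x (n + 1))))
          - (grad A b (x (n + 1)) ⬝ᵥ A *ᵥ grad A b (x (n + 1)))
            / (alphaMG A (grad A b (x n)) ^ 2 * (grad A b (x n) ⬝ᵥ A *ᵥ grad A b (x n))))
      atTop (𝓝 (eig ⟨0, by omega⟩ * eig ⟨N - 1, by omega⟩)) := by
  have ha : ∀ i, eig ⟨0, by omega⟩ ≤ eig i := fun i =>
    heig.monotone (Fin.mk_le_of_le_val (Nat.zero_le _))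
  have hc : ∀ i, eig i ≤ eig ⟨N - 1, by omega⟩ := fun i =>
    heig.monotone (Fin.le_def.2 (by have := i.2; simp only; omega))
  have hac : eig ⟨0, by omega⟩ < eig ⟨N - 1, by omega⟩ :=
    heig (Fin.lt_def.2 (by simp only; omega))
  have hpos := eigenvalue_pos hA hv
  obtain ⟨p, hstep, hp, h1, hpa, hpc, hmean, hvar⟩ :=
    exists_spectral_weights hA hx hv heig.injective hζ ha hc hac hfirst hlast
  obtain ⟨hS, hP⟩ := tendsto_wquad_coeff heig.injective hstep hp h1 ha hc hac hpa hpc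
  have hlo := hpos ⟨0, by omega⟩
  have hhi := hpos ⟨N - 1, by omega⟩
  generalize eig ⟨0, by omega⟩ = lo at *
  generalize eig ⟨N - 1, by omega⟩ = hi at *
  refine ⟨?_, ?_, ?_⟩
  · simp only [alphaA2, hmean, one_div]
    exact hS.inv₀ (by positivity)
  · simp only [alphaY2, mul_div_assoc, hvar, hmean]
    -- The radicand is (m + m')² - 4(m m' - s), the discriminant of Q, so Y2 tends to the reciprocal
    -- of the larger limiting root.
    have hD : Tendsto (fun n => √((wmean eig (p n) - wmean eig (p (n + 1))) ^ 2
        + 4 * wvar eig (p n))) atTop (𝓝 (hi - lo)) := by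
      have h := ((hS.pow 2).sub (hP.const_mul 4)).sqrt
      rw [show (lo + hi) ^ 2 - 4 * (lo * hi) = (hi - lo) ^ 2 by ring,
        Real.sqrt_sq (by linarith)] at h
      exact h.congr fun n => by congr 1; ring
    have h := ((hD.add hS).inv₀ (by linarith)).const_mul 2
    rw [show 2 * (hi - lo + (lo + hi))⁻¹ = 1 / hi by
      rw [show hi - lo + (lo + hi) = 2 * hi by ring, mul_inv, one_div]; ring] at h
    exact h.congr fun n => by rw [add_assoc]
  · simp only [hvar, ← one_div_mul_one_div, hmean]
    exact hP
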